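/- Let $\mathbb F$ be a field. A \emph{triassociative algebra} is an $\mathbb F$-vector space $L$ with three bilinear products $\vdash,\dashv,\perp$ satisfying, for all $x,y,z\in L$, \begin{align*} &(x\vdash y)\vdash z=x\vdash(y\vdash z), && (x\dashv y)\dashv z=x\dashv(y\dashv z), && (x\dashv y)\vdash z=x\vdash(y\vdash z),\\ &(x\dashv y)\dashv z=x\dashv(y\vdash z), && (x\vdash y)\dashv z=x\vdash(y\dashv z), && (x\perp y)\vdash z=x\vdash(y\vdash z),\\ &(x\dashv y)\dashv z=x\dashv(y\perp z), && (x\vdash y)\perp z=x\vdash(y\perp z), && (x\perp y)\dashv z=x\perp(y\dashv z),\\ &(x\dashv y)\perp z=x\perp(y\vdash z), && (x\perp y)\perp z=x\perp(y\perp z). \end{align*} Ideals are two-sided for all three products. The center $Z(L)$ consists of the $z\in L$ with $z*x=x*z=0$ for all $x\in L$ and $*\in\{\vdash,\dashv,\perp\}$. For subspaces $S,T$ put $S\lozenge T=S\vdash T+S\dashv T+S\perp T$ (spans of products), and $L'=L\lozenge L$. \emph{Multiplier.} A defining pair of $L$ is a triassociative algebra $K$ with an ideal $M\subseteq Z(K)\cap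 K'$ such that $K/M\cong L$. If $\dim K$ is maximal among all defining pairs of $L$, then $M$ is called the multiplier $M(L)$ of $L$; it has zero products and is unique up to isomorphism. \emph{The map $\delta$.} Let $\mathcal Z^2(L,\mathbb F)$ be the space of triples $(f_\vdash,f_\dashv,f_\perp)$ of bilinear forms on $L$ such that $f_b(x\mathbin{a}y,z)=f_c(x,y\mathbin{d}z)$ for each of the eleven relations $(x\mathbin{a}y)\mathbin{b}z=x\mathbin{c}(y\mathbin{d}z)$ above, $\mathcal B^2(L,\mathbb F)$ the subspace of triples $f_*(x,y)=-\varepsilon(x*y)$ with $\varepsilon:L\to\mathbb F$ linear, and $\mathcal H^2(L,\mathbb F)=\mathcal Z^2(L,\mathbb F)/\mathcal B^2(L,\mathbb F)$ (which is isomorphic to $M(L)$ if $L$ is finite-dimensional). For a central ideal $Z$ of $L$ let \[\delta:\mathcal H^2(L,\mathbb F)\to\bigl(\mathrm{Bil}(L/L'\times Z,\mathbb F)\oplus\mathrm{Bil}(Z\times L/L',\mathbb F)\bigr)^3\] be the linear map sending the class of $(f_\vdash,f_\dashv,f_\perp)$ to the forms $(x+L',z)\mapsto f_*(x,z)$ and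 $(z,x+L')\mapsto f_*(z,x)$, $*\in\{\vdash,\dashv,\perp\}$. For finite-dimensional $L$ its target is isomorphic to $(L/L'\otimes Z\oplus Z\otimes L/L')^3$. \emph{The natural map $\beta$.} Let $\pi:F\to L$ be a free presentation, i.e. a surjective homomorphism from a free triassociative algebra $F$, let $R=\ker\pi$, and let $T=\pi^{-1}(Z)$ be the kernel of the free presentation $F\to L/Z$. In terms of it, \[\beta:M(L)=\frac{R\cap F'}{F\lozenge R+R\lozenge F}\longrightarrow M(L/Z)=\frac{T\cap F'}{F\lozenge T+T\lozenge F}\] is the map induced by the inclusion $R\subseteq T$. \emph{The ideal $Z^*(L)$} is the intersection of all $\omega(Z(E))$, where $\omega:E\to L$ runs through the surjective homomorphisms of triassociative algebras with $\ker\omega\subseteq Z(E)$. \textbf{Theorem.} Let $Z$ be a central ideal (i.e. an ideal contained in $Z(L)$) of a finite-dimensional triassociative algebra $L$ over $\mathbb F$. For any free presentation $\pi:F\to L$, the following are equivalent: \begin{enumerate} \item $\delta=0$; \item the natural map $\beta:M(L)\to M(L/Z)$ is injective; \item $M(L)\cong M(L/Z)/(L'\cap Z)$, that is, there is an injective linear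 map $i:L'\cap Z\to M(L/Z)$ with $M(L)\cong M(L/Z)/i(L'\cap Z)$; \item $Z\subseteq Z^*(L)$. \end{enumerate} -/

import Mathlib

universe u v w

/-- The three products of a triassociative algebra: `⊢`, `⊣` and `⊥`. -/
inductive TriOp : Type
  | vdash : TriOp
  | dashv : TriOp
  | perp : TriOp

/-- The eleven triassociative relations: `TriRel a b c d` stands for the relation
`(x a y) b z = x c (y d z)`. -/
inductive TriRel : TriOp → TriOp → TriOp → TriOp → Prop
  /-- `(x ⊢ y) ⊢ z = x ⊢ (y ⊢ z)` -/
  | r1 : TriRel .vdash .vdash .vdash .vdash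
  /-- `(x ⊣ y) ⊣ z = x ⊣ (y ⊣ z)` -/
  | r2 : TriRel .dashv .dashv .dashv .dashv
  /-- `(x ⊣ y) ⊢ z = x ⊢ (y ⊢ z)` -/
  | r3 : TriRel .dashv .vdash .vdash .vdash
  /-- `(x ⊣ y) ⊣ z = x ⊣ (y ⊢ z)` -/
  | r4 : TriRel .dashv .dashv .dashv .vdash
  /-- `(x ⊢ y) ⊣ z = x ⊢ (y ⊣ z)` -/
  | r5 : TriRel .vdash .dashv .vdash .dashv
  /-- `(x ⊥ y) ⊢ z = x ⊢ (y ⊢ z)` -/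
  | r6 : TriRel .perp .vdash .vdash .vdash
  /-- `(x ⊣ y) ⊣ z = x ⊣ (y ⊥ z)` -/
  | r7 : TriRel .dashv .dashv .dashv .perp
  /-- `(x ⊢ y) ⊥ z = x ⊢ (y ⊥ z)` -/
  | r8 : TriRel .vdash .perp .vdash .perp
  /-- `(x ⊥ y) ⊣ z = x ⊥ (y ⊣ z)` -/
  | r9 : TriRel .perp .dashv .perp .dashv
  /-- `(x ⊣ y) ⊥ z = x ⊥ (y ⊢ z)` -/
  | r10 : TriRel .dashv .perp .perp .vdash
  /-- `(x ⊥ y) ⊥ z = x ⊥ (y ⊥ z)` -/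
  | r11 : TriRel .perp .perp .perp .perp

/-- A triassociative algebra: a vector space with three bilinear products satisfying the eleven
relations of `TriRel`. -/
class TriAlgebra (𝕜 : Type u) (L : Type v) [Field 𝕜] [AddCommGroup L] [Module 𝕜 L] where
  /-- the products -/
  op : TriOp → L →ₗ[𝕜] L →ₗ[𝕜] L
  /-- the triassociative relations -/
  rel : ∀ {a b c d : TriOp}, TriRel a b c d → ∀ x y z : L,
    op b (op a x y) z = op c x (op d y z)

/-- Homomorphisms of triassociative algebras. -/
structure TriHom (𝕜 : Type u) (L : Type v) (N : Type w) [Field 𝕜]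
    [AddCommGroup L] [Module 𝕜 L] [TriAlgebra 𝕜 L]
    [AddCommGroup N] [Module 𝕜 N] [TriAlgebra 𝕜 N] extends L →ₗ[𝕜] N where
  map_op : ∀ (o : TriOp) (x y : L),
    toFun (TriAlgebra.op (𝕜 := 𝕜) o x y) = TriAlgebra.op (𝕜 := 𝕜) o (toFun x) (toFun y)

/-- Two-sided ideals (for all three products). -/
structure TriIdeal (𝕜 : Type u) (L : Type v) [Field 𝕜]
    [AddCommGroup L] [Module 𝕜 L] [TriAlgebra 𝕜 L] extends Submodule 𝕜 L where
  op_left_mem : ∀ (o : TriOp) (x : L) {y : L}, y ∈ carrier → TriAlgebra.op (𝕜 := 𝕜) o x y ∈ carrier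
  op_right_mem : ∀ (o : TriOp) {x : L} (y : L), x ∈ carrier → TriAlgebra.op (𝕜 := 𝕜) o x y ∈ carrier

/-- The composite of two homomorphisms. -/
def TriHom.comp {𝕜 : Type u} {L₁ : Type*} {L₂ : Type*} {L₃ : Type*} [Field 𝕜]
    [AddCommGroup L₁] [Module 𝕜 L₁] [TriAlgebra 𝕜 L₁]
    [AddCommGroup L₂] [Module 𝕜 L₂] [TriAlgebra 𝕜 L₂]
    [AddCommGroup L₃] [Module 𝕜 L₃] [TriAlgebra 𝕜 L₃]
    (g : TriHom 𝕜 L₂ L₃) (f : TriHom 𝕜 L₁ L₂) : TriHom 𝕜 L₁ L₃ where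
  toLinearMap := g.toLinearMap ∘ₗ f.toLinearMap
  map_op := fun o x y =>
    (congrArg g.toLinearMap (f.map_op o x y)).trans
      (g.map_op o (f.toLinearMap x) (f.toLinearMap y))

/-- A bilinear product `m` on `V` that preserves the subspace `p` on both sides descends to the
quotient `V ⧸ p`. -/
def quotientProduct {𝕜 : Type u} {V : Type v} [Field 𝕜] [AddCommGroup V] [Module 𝕜 V]
    (p : Submodule 𝕜 V) (m : V →ₗ[𝕜] V →ₗ[𝕜] V)
    (hl : ∀ (x : V) {y : V}, y ∈ p → m x y ∈ p) (hr : ∀ {x : V} (y : V), x ∈ p → m x y ∈ p) :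
    (V ⧸ p) →ₗ[𝕜] (V ⧸ p) →ₗ[𝕜] (V ⧸ p) :=
  p.liftQ
    { toFun := fun x => p.mapQ p (m x) (fun _ hy => hl x hy)
      map_add' := fun x y => by ext z; simp
      map_smul' := fun c x => by ext z; simp }
    (fun x hx => by
      rw [LinearMap.mem_ker]
      ext y
      simpa [Submodule.Quotient.mk_eq_zero] using hr y hx)

theorem quotientProduct_mk {𝕜 : Type u} {V : Type v} [Field 𝕜] [AddCommGroup V] [Module 𝕜 V]
    (p : Submodule 𝕜 V) (m : V →ₗ[𝕜] V →ₗ[𝕜] V)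
    (hl : ∀ (x : V) {y : V}, y ∈ p → m x y ∈ p) (hr : ∀ {x : V} (y : V), x ∈ p → m x y ∈ p)
    (x y : V) :
    quotientProduct p m hl hr (Submodule.Quotient.mk x) (Submodule.Quotient.mk y) =
      Submodule.Quotient.mk (m x y) := rfl

section Basic

variable (𝕜 : Type u) (L : Type v) [Field 𝕜] [AddCommGroup L] [Module 𝕜 L] [TriAlgebra 𝕜 L]

/-- The center `Z(L)`. -/
def triCenter : Submodule 𝕜 L where
  carrier := {z | ∀ (o : TriOp) (x : L),
    TriAlgebra.op (𝕜 := 𝕜) o z x = 0 ∧ TriAlgebra.op (𝕜 := 𝕜) o x z = 0}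
  zero_mem' := fun o x => by simp
  add_mem' := fun {a b} ha hb o x => by
    simp [(ha o x).1, (ha o x).2, (hb o x).1, (hb o x).2]
  smul_mem' := fun c a ha o x => by simp [(ha o x).1, (ha o x).2]

variable {𝕜 L}

/-- `S ◇ T = S ⊢ T + S ⊣ T + S ⊥ T`. -/
def triDiamond (S T : Submodule 𝕜 L) : Submodule 𝕜 L :=
  ⨆ o : TriOp, Submodule.map₂ (TriAlgebra.op (𝕜 := 𝕜) o) S T

variable (𝕜 L)

/-- The derived algebra `L' = L ◇ L`. -/
def triDerived : Submodule 𝕜 L := triDiamond (𝕜 := 𝕜) (L := L) ⊤ ⊤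

variable {𝕜 L}

/-- The quotient of a triassociative algebra by an ideal. -/
instance TriIdeal.quotientTriAlgebra (I : TriIdeal 𝕜 L) : TriAlgebra 𝕜 (L ⧸ I.toSubmodule) where
  op := fun o => quotientProduct I.toSubmodule (TriAlgebra.op (𝕜 := 𝕜) o)
    (fun x _ hy => I.op_left_mem o x hy) (fun y hx => I.op_right_mem o y hx)
  rel := fun {a b c d} h x y z => by
    induction x using Submodule.Quotient.induction_on with | H x =>
    induction y using Submodule.Quotient.induction_on with | H y =>
    induction z using Submodule.Quotient.induction_on with | H z =>
    simp only [quotientProduct_mk]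
    rw [TriAlgebra.rel h]

/-- The quotient map `L → L / I`. -/
def TriIdeal.mkHom (I : TriIdeal 𝕜 L) : TriHom 𝕜 L (L ⧸ I.toSubmodule) where
  toLinearMap := I.toSubmodule.mkQ
  map_op := fun _ _ _ => rfl

end Basic

section DefiningPairs

variable (𝕜 : Type u) (L : Type v) [Field 𝕜] [AddCommGroup L] [Module 𝕜 L] [TriAlgebra 𝕜 L]

/-- `(K, M)` is a defining pair for `L`: `K / M ≅ L` and `M ⊆ Z(K) ∩ K'`. -/
def IsDefiningPair (K : Type w) [AddCommGroup K] [Module 𝕜 K] [TriAlgebra 𝕜 K]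
    (M : TriIdeal 𝕜 K) : Prop :=
  (∃ φ : TriHom 𝕜 (K ⧸ M.toSubmodule) L, Function.Bijective φ.toLinearMap) ∧
    M.toSubmodule ≤ triCenter 𝕜 K ⊓ triDerived 𝕜 K

/-- `(K, M)` is a maximal defining pair for `L`, i.e. a defining pair with `dim K` maximal.
Then `K` is a cover and `M` is the multiplier `M(L)` of `L`. -/
def IsMaximalDefiningPair (K : Type (max u v)) [AddCommGroup K] [Module 𝕜 K] [TriAlgebra 𝕜 K]
    (M : TriIdeal 𝕜 K) : Prop :=
  IsDefiningPair 𝕜 L K M ∧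
    ∀ (K₁ : Type (max u v)) [AddCommGroup K₁] [Module 𝕜 K₁] [TriAlgebra 𝕜 K₁]
      (M₁ : TriIdeal 𝕜 K₁), IsDefiningPair 𝕜 L K₁ M₁ → Module.rank 𝕜 K₁ ≤ Module.rank 𝕜 K

/-- `Z^*(L)`: the intersection of all `ω(Z(E))`, where `ω : E → L` runs through the central
extensions of `L`. -/
def triZStar : Submodule 𝕜 L :=
  sInf {N | ∃ (E : Type (max u v)) (_ : AddCommGroup E) (_ : Module 𝕜 E) (_ : TriAlgebra 𝕜 E)
    (ω : TriHom 𝕜 E L), Function.Surjective ω.toLinearMap ∧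
      LinearMap.ker ω.toLinearMap ≤ triCenter 𝕜 E ∧
      N = (triCenter 𝕜 E).map ω.toLinearMap}

end DefiningPairs

section Cohomology

/-- Triples `(f_⊢, f_⊣, f_⊥)` of bilinear forms on `L`, with the pointwise vector space
structure. -/
def TriForms (𝕜 : Type u) (L : Type v) [Field 𝕜] [AddCommGroup L] [Module 𝕜 L] :
    Type (max u v) :=
  TriOp → L →ₗ[𝕜] L →ₗ[𝕜] 𝕜

section

variable (𝕜 : Type u) (L : Type v) [Field 𝕜] [AddCommGroup L] [Module 𝕜 L]

instance TriForms.instAddCommGroup : AddCommGroup (TriForms 𝕜 L) :=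
  inferInstanceAs (AddCommGroup (TriOp → L →ₗ[𝕜] L →ₗ[𝕜] 𝕜))

instance TriForms.instModule : Module 𝕜 (TriForms 𝕜 L) :=
  inferInstanceAs (Module 𝕜 (TriOp → L →ₗ[𝕜] L →ₗ[𝕜] 𝕜))

variable {𝕜 L}

theorem TriForms.zero_apply (o : TriOp) (x y : L) : (0 : TriForms 𝕜 L) o x y = 0 := rfl

theorem TriForms.add_apply (f g : TriForms 𝕜 L) (o : TriOp) (x y : L) :
    (f + g) o x y = f o x y + g o x y := rfl

theorem TriForms.smul_apply (r : 𝕜) (f : TriForms 𝕜 L) (o : TriOp) (x y : L) :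
    (r • f) o x y = r * f o x y := rfl

end

variable (𝕜 : Type u) (L : Type v) [Field 𝕜] [AddCommGroup L] [Module 𝕜 L] [TriAlgebra 𝕜 L]

/-- The 2-cocycles of `L` with coefficients in the field: triples `(f_⊢, f_⊣, f_⊥)` of bilinear
forms satisfying the eleven identities `f_b(x a y, z) = f_c(x, y d z)`. -/
def triZ2 : Submodule 𝕜 (TriForms 𝕜 L) where
  carrier := {f | ∀ {a b c d : TriOp}, TriRel a b c d → ∀ x y z : L,
    f b (TriAlgebra.op (𝕜 := 𝕜) a x y) z = f c x (TriAlgebra.op (𝕜 := 𝕜) d y z)}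
  zero_mem' := fun _ _ _ _ => rfl
  add_mem' := fun {f g} hf hg _ _ _ _ h x y z => by
    simp only [TriForms.add_apply, hf h x y z, hg h x y z]
  smul_mem' := fun r f hf _ _ _ _ h x y z => by
    simp only [TriForms.smul_apply, hf h x y z]

/-- The 2-coboundaries: triples of the form `f_*(x, y) = -ε(x * y)` for a linear form `ε`
(these are automatically cocycles). -/
def triB2 : Submodule 𝕜 (TriForms 𝕜 L) where
  carrier := {f | ∃ ε : L →ₗ[𝕜] 𝕜, ∀ (o : TriOp) (x y : L),
    f o x y = -ε (TriAlgebra.op (𝕜 := 𝕜) o x y)}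
  zero_mem' := ⟨0, fun o x y => by simp [TriForms.zero_apply]⟩
  add_mem' := by
    rintro f g ⟨ε, hε⟩ ⟨η, hη⟩
    exact ⟨ε + η, fun o x y => by simp [TriForms.add_apply, hε, hη, add_comm]⟩
  smul_mem' := by
    rintro r f ⟨ε, hε⟩
    exact ⟨r • ε, fun o x y => by simp [TriForms.smul_apply, hε]⟩

/-- `H²(L, 𝕜) = Z²(L, 𝕜) / B²(L, 𝕜)`. -/
abbrev triH2 : Type (max u v) := ↥(triZ2 𝕜 L) ⧸ (triB2 𝕜 L).submoduleOf (triZ2 𝕜 L)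

variable {𝕜 L}

theorem triDerived_le {N : Type*} [AddCommGroup N] [Module 𝕜 N] (g : L →ₗ[𝕜] N)
    (h : ∀ (o : TriOp) (x y : L), g (TriAlgebra.op (𝕜 := 𝕜) o x y) = 0) :
    triDerived 𝕜 L ≤ LinearMap.ker g :=
  iSup_le fun o => Submodule.map₂_le.2 fun x _ y _ => h o x y

theorem triZ2_left_zero {f : TriForms 𝕜 L} (hf : f ∈ triZ2 𝕜 L) {z : L}
    (hz : z ∈ triCenter 𝕜 L) (o p : TriOp) (x y : L) :
    f o (TriAlgebra.op (𝕜 := 𝕜) p x y) z = 0 := by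
  have key : ∀ {c d : TriOp}, TriRel p o c d →
      f o (TriAlgebra.op (𝕜 := 𝕜) p x y) z = 0 := fun {c d} h => by
    rw [hf h x y z, (hz d y).2, map_zero]
  cases o <;> cases p
  · exact key .r1
  · exact key .r3
  · exact key .r6
  · exact key .r5
  · exact key .r2
  · exact key .r9
  · exact key .r8
  · exact key .r10
  · exact key .r11

theorem triZ2_right_zero {f : TriForms 𝕜 L} (hf : f ∈ triZ2 𝕜 L) {z : L}
    (hz : z ∈ triCenter 𝕜 L) (o p : TriOp) (x y : L) :
    f o z (TriAlgebra.op (𝕜 := 𝕜) p x y) = 0 := by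
  have key : ∀ {a b : TriOp}, TriRel a b o p →
      f o z (TriAlgebra.op (𝕜 := 𝕜) p x y) = 0 := fun {a b} h => by
    rw [← hf h z x y, (hz a x).1, map_zero, LinearMap.zero_apply]
  cases o <;> cases p
  · exact key .r1
  · exact key .r5
  · exact key .r8
  · exact key .r4
  · exact key .r2
  · exact key .r7
  · exact key .r10
  · exact key .r9
  · exact key .r11

/-- The space `(Bil(L/L' × Z, 𝕜) ⊕ Bil(Z × L/L', 𝕜))³`. -/
def TriDeltaTarget (Z : TriIdeal 𝕜 L) : Type (max u v) :=
  TriOp →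
    ((L ⧸ triDerived 𝕜 L) →ₗ[𝕜] Z.toSubmodule →ₗ[𝕜] 𝕜) ×
    (Z.toSubmodule →ₗ[𝕜] (L ⧸ triDerived 𝕜 L) →ₗ[𝕜] 𝕜)

instance TriDeltaTarget.instAddCommGroup (Z : TriIdeal 𝕜 L) : AddCommGroup (TriDeltaTarget Z) :=
  inferInstanceAs (AddCommGroup (TriOp →
    ((L ⧸ triDerived 𝕜 L) →ₗ[𝕜] Z.toSubmodule →ₗ[𝕜] 𝕜) ×
    (Z.toSubmodule →ₗ[𝕜] (L ⧸ triDerived 𝕜 L) →ₗ[𝕜] 𝕜)))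

instance TriDeltaTarget.instModule (Z : TriIdeal 𝕜 L) : Module 𝕜 (TriDeltaTarget Z) :=
  inferInstanceAs (Module 𝕜 (TriOp →
    ((L ⧸ triDerived 𝕜 L) →ₗ[𝕜] Z.toSubmodule →ₗ[𝕜] 𝕜) ×
    (Z.toSubmodule →ₗ[𝕜] (L ⧸ triDerived 𝕜 L) →ₗ[𝕜] 𝕜)))

/-- `Z²(L, 𝕜) → (Bil(L/L' × Z, 𝕜) ⊕ Bil(Z × L/L', 𝕜))³`, sending a cocycle `f` to the forms
`f''_*(x + L', z) = f_*(x, z)` and `g''_*(z, x + L') = f_*(z, x)`. -/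
def triDeltaZ2 (Z : TriIdeal 𝕜 L) (hZ : Z.toSubmodule ≤ triCenter 𝕜 L) :
    triZ2 𝕜 L →ₗ[𝕜] TriDeltaTarget Z where
  toFun := fun f o =>
    ((triDerived 𝕜 L).liftQ ((LinearMap.lcomp 𝕜 𝕜 Z.toSubmodule.subtype) ∘ₗ f.1 o)
      (triDerived_le _ fun p x y => LinearMap.ext fun z =>
        triZ2_left_zero f.2 (hZ z.2) o p x y),
    ((triDerived 𝕜 L).liftQ (f.1 o ∘ₗ Z.toSubmodule.subtype).flip
      (triDerived_le _ fun p x y => LinearMap.ext fun z =>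
        triZ2_right_zero f.2 (hZ z.2) o p x y)).flip)
  map_add' := fun f g => by
    funext o
    refine Prod.ext ?_ ?_
    · ext x z; rfl
    · refine LinearMap.ext fun z => ?_
      ext x; rfl
  map_smul' := fun r f => by
    funext o
    refine Prod.ext ?_ ?_
    · ext x z; rfl
    · refine LinearMap.ext fun z => ?_
      ext x; rfl

theorem triDeltaZ2_fst_mk (Z : TriIdeal 𝕜 L) (hZ : Z.toSubmodule ≤ triCenter 𝕜 L)
    (f : triZ2 𝕜 L) (o : TriOp) (x : L) (z : Z.toSubmodule) :
    (triDeltaZ2 Z hZ f o).1 (Submodule.Quotient.mk x) z = f.1 o x z := rfl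

theorem triDeltaZ2_snd_mk (Z : TriIdeal 𝕜 L) (hZ : Z.toSubmodule ≤ triCenter 𝕜 L)
    (f : triZ2 𝕜 L) (o : TriOp) (x : L) (z : Z.toSubmodule) :
    (triDeltaZ2 Z hZ f o).2 z (Submodule.Quotient.mk x) = f.1 o z x := rfl

theorem triDeltaZ2_coboundary (Z : TriIdeal 𝕜 L) (hZ : Z.toSubmodule ≤ triCenter 𝕜 L)
    (f : triZ2 𝕜 L) (hf : f.1 ∈ triB2 𝕜 L) : triDeltaZ2 Z hZ f = 0 := by
  obtain ⟨ε, hε⟩ := hf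
  funext o
  refine Prod.ext ?_ ?_
  · ext x z
    refine (hε o x z).trans ?_
    rw [(hZ z.2 o x).2, map_zero, neg_zero]; rfl
  · refine LinearMap.ext fun z => ?_
    ext x
    refine (hε o z x).trans ?_
    rw [(hZ z.2 o x).1, map_zero, neg_zero]; rfl

/-- The map `δ : H²(L, 𝕜) → (Bil(L/L' × Z, 𝕜) ⊕ Bil(Z × L/L', 𝕜))³` induced by `triDeltaZ2`. -/
def triDelta (Z : TriIdeal 𝕜 L) (hZ : Z.toSubmodule ≤ triCenter 𝕜 L) :
    triH2 𝕜 L →ₗ[𝕜] TriDeltaTarget Z :=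
  ((triB2 𝕜 L).submoduleOf (triZ2 𝕜 L)).liftQ (triDeltaZ2 Z hZ) fun f hf =>
    triDeltaZ2_coboundary Z hZ f hf

end Cohomology

section Free

/-- Formal products of elements of `X`: the free set with three binary operations. -/
inductive TriTerm (X : Type w) : Type w
  | of : X → TriTerm X
  | node : TriOp → TriTerm X → TriTerm X → TriTerm X

variable (𝕜 : Type u) (X : Type w) [Field 𝕜]

/-- The bilinear extension of the formal products to the vector space with basis `TriTerm X`. -/
noncomputable def triTermOp (o : TriOp) :
    (TriTerm X →₀ 𝕜) →ₗ[𝕜] (TriTerm X →₀ 𝕜) →ₗ[𝕜] (TriTerm X →₀ 𝕜) :=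
  Finsupp.linearCombination 𝕜 fun s => Finsupp.lmapDomain 𝕜 𝕜 (TriTerm.node o s)

/-- The subspaces that are stable under formal products on both sides and contain the differences
of the two sides of the triassociative relations. -/
def IsTriRelationIdeal (I : Submodule 𝕜 (TriTerm X →₀ 𝕜)) : Prop :=
  (∀ (o : TriOp) (x y : TriTerm X →₀ 𝕜), y ∈ I → triTermOp 𝕜 X o x y ∈ I) ∧
  (∀ (o : TriOp) (x y : TriTerm X →₀ 𝕜), x ∈ I → triTermOp 𝕜 X o x y ∈ I) ∧
  ∀ {a b c d : TriOp}, TriRel a b c d → ∀ x y z : TriTerm X →₀ 𝕜,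
    triTermOp 𝕜 X b (triTermOp 𝕜 X a x y) z - triTermOp 𝕜 X c x (triTermOp 𝕜 X d y z) ∈ I

/-- The ideal generated by the triassociative relations. -/
noncomputable def triRelationIdeal : Submodule 𝕜 (TriTerm X →₀ 𝕜) :=
  sInf {I | IsTriRelationIdeal 𝕜 X I}

theorem isTriRelationIdeal_triRelationIdeal :
    IsTriRelationIdeal 𝕜 X (triRelationIdeal 𝕜 X) := by
  refine ⟨fun o x y hy => ?_, fun o x y hx => ?_, fun {a b c d} h x y z => ?_⟩
  · exact Submodule.mem_sInf.2 fun I hI => hI.1 o x y (Submodule.mem_sInf.1 hy I hI)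
  · exact Submodule.mem_sInf.2 fun I hI => hI.2.1 o x y (Submodule.mem_sInf.1 hx I hI)
  · exact Submodule.mem_sInf.2 fun I hI => hI.2.2 h x y z

/-- The free triassociative algebra on the set `X`. -/
abbrev FreeTri : Type (max u w) := (TriTerm X →₀ 𝕜) ⧸ triRelationIdeal 𝕜 X

noncomputable instance FreeTri.instTriAlgebra : TriAlgebra 𝕜 (FreeTri 𝕜 X) where
  op := fun o => quotientProduct (triRelationIdeal 𝕜 X) (triTermOp 𝕜 X o)
    (fun x _ hy => (isTriRelationIdeal_triRelationIdeal 𝕜 X).1 o x _ hy)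
    (fun y hx => (isTriRelationIdeal_triRelationIdeal 𝕜 X).2.1 o _ y hx)
  rel := fun {a b c d} h x y z => by
    induction x using Submodule.Quotient.induction_on with | H x =>
    induction y using Submodule.Quotient.induction_on with | H y =>
    induction z using Submodule.Quotient.induction_on with | H z =>
    simp only [quotientProduct_mk]
    exact (Submodule.Quotient.eq _).2 ((isTriRelationIdeal_triRelationIdeal 𝕜 X).2.2 h x y z)

variable {X}

/-- The generators of the free triassociative algebra. -/
noncomputable def FreeTri.of (x : X) : FreeTri 𝕜 X :=
  Submodule.Quotient.mk (Finsupp.single (TriTerm.of x) 1)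

variable {𝕜} {E : Type v} [AddCommGroup E] [Module 𝕜 E] [TriAlgebra 𝕜 E]

/-- Evaluation of a formal product in a triassociative algebra. -/
def TriTerm.eval (𝕜 : Type u) [Field 𝕜] [Module 𝕜 E] [TriAlgebra 𝕜 E] (g : X → E) :
    TriTerm X → E
  | .of x => g x
  | .node o s t => TriAlgebra.op (𝕜 := 𝕜) o (TriTerm.eval 𝕜 g s) (TriTerm.eval 𝕜 g t)

theorem triTermEval_op (g : X → E) (o : TriOp) (x y : TriTerm X →₀ 𝕜) :
    Finsupp.linearCombination 𝕜 (TriTerm.eval 𝕜 g) (triTermOp 𝕜 X o x y) =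
      TriAlgebra.op (𝕜 := 𝕜) o (Finsupp.linearCombination 𝕜 (TriTerm.eval 𝕜 g) x)
        (Finsupp.linearCombination 𝕜 (TriTerm.eval 𝕜 g) y) := by
  induction x using Finsupp.induction_linear with
  | zero => simp
  | add x₁ x₂ h₁ h₂ => simp [h₁, h₂]
  | single s r =>
    induction y using Finsupp.induction_linear with
    | zero => simp
    | add y₁ y₂ h₁ h₂ => simp only [map_add, h₁, h₂]
    | single t q =>
      simp [triTermOp, TriTerm.eval, Finsupp.mapDomain_single, -Finsupp.single_mul, smul_smul,
        mul_comm]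

/-- The universal property of the free triassociative algebra. -/
theorem FreeTri.existsUnique_lift (g : X → E) :
    ∃! φ : TriHom 𝕜 (FreeTri 𝕜 X) E, ∀ x, φ.toLinearMap (FreeTri.of 𝕜 x) = g x := by
  have hle : triRelationIdeal 𝕜 X ≤
      LinearMap.ker (Finsupp.linearCombination 𝕜 (TriTerm.eval 𝕜 g)) := by
    refine sInf_le ⟨fun o x y hy => ?_, fun o x y hx => ?_, fun {a b c d} h x y z => ?_⟩
    · rw [LinearMap.mem_ker] at hy ⊢
      rw [triTermEval_op, hy, map_zero]
    · rw [LinearMap.mem_ker] at hx ⊢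
      rw [triTermEval_op, hx, map_zero, LinearMap.zero_apply]
    · rw [LinearMap.mem_ker, map_sub, triTermEval_op, triTermEval_op, triTermEval_op,
        triTermEval_op, TriAlgebra.rel h, sub_self]
  refine ⟨⟨(triRelationIdeal 𝕜 X).liftQ _ hle, fun o x y => ?_⟩, fun x => ?_, fun ψ hψ => ?_⟩
  · induction x using Submodule.Quotient.induction_on with | H x =>
    induction y using Submodule.Quotient.induction_on with | H y =>
    exact triTermEval_op g o x y
  · exact (Finsupp.linearCombination_single 𝕜 (1 : 𝕜) (TriTerm.of x)).trans (one_smul 𝕜 (g x))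
  · have hterm : ∀ t : TriTerm X,
        ψ.toLinearMap (Submodule.Quotient.mk (Finsupp.single t 1)) = TriTerm.eval 𝕜 g t := by
      intro t
      induction t with
      | of x => exact hψ x
      | node o s t hs ht =>
        have h1 : (Submodule.Quotient.mk (Finsupp.single (TriTerm.node o s t) 1) : FreeTri 𝕜 X) =
            TriAlgebra.op (𝕜 := 𝕜) o
              (Submodule.Quotient.mk (Finsupp.single s 1) : FreeTri 𝕜 X)
              (Submodule.Quotient.mk (Finsupp.single t 1) : FreeTri 𝕜 X) := by
          refine congrArg Submodule.Quotient.mk ?_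
          simp [triTermOp, Finsupp.mapDomain_single]
        rw [h1]
        refine (ψ.map_op o _ _).trans ?_
        exact congrArg₂ (fun p q => TriAlgebra.op (𝕜 := 𝕜) o p q) hs ht
    cases ψ with
    | mk ψ hop =>
      congr 1
      ext t
      simpa using hterm t

end Free

section Presentation

variable {𝕜 : Type u} {F : Type*} {L : Type*} {N : Type*} [Field 𝕜]
  [AddCommGroup F] [Module 𝕜 F] [TriAlgebra 𝕜 F]
  [AddCommGroup L] [Module 𝕜 L] [TriAlgebra 𝕜 L]
  [AddCommGroup N] [Module 𝕜 N] [TriAlgebra 𝕜 N]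

/-- `F ◇ R + R ◇ F` for `R = ker π`. -/
def presCommutator (π : TriHom 𝕜 F L) : Submodule 𝕜 F :=
  triDiamond ⊤ (LinearMap.ker π.toLinearMap) ⊔ triDiamond (LinearMap.ker π.toLinearMap) ⊤

/-- `R ∩ F'` for `R = ker π`. -/
def presNumerator (π : TriHom 𝕜 F L) : Submodule 𝕜 F :=
  LinearMap.ker π.toLinearMap ⊓ triDerived 𝕜 F

/-- The multiplier in terms of a free presentation `π : F → L` with kernel `R`:
`(R ∩ F') / (F ◇ R + R ◇ F)`. -/
abbrev PresMultiplier (π : TriHom 𝕜 F L) : Type _ :=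
  ↥(presNumerator π) ⧸ (presCommutator π).submoduleOf (presNumerator π)

theorem ker_le_ker_comp (φ : TriHom 𝕜 L N) (π : TriHom 𝕜 F L) :
    LinearMap.ker π.toLinearMap ≤ LinearMap.ker (φ.comp π).toLinearMap :=
  LinearMap.ker_le_ker_comp π.toLinearMap φ.toLinearMap

theorem presNumerator_mono (φ : TriHom 𝕜 L N) (π : TriHom 𝕜 F L) :
    presNumerator π ≤ presNumerator (φ.comp π) :=
  inf_le_inf_right _ (ker_le_ker_comp φ π)

theorem presCommutator_mono (φ : TriHom 𝕜 L N) (π : TriHom 𝕜 F L) :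
    presCommutator π ≤ presCommutator (φ.comp π) :=
  sup_le_sup (iSup_mono fun _ => Submodule.map₂_le_map₂_right (ker_le_ker_comp φ π))
    (iSup_mono fun _ => Submodule.map₂_le_map₂_left (ker_le_ker_comp φ π))

/-- For a free presentation `π : F → L` with kernel `R` and a surjection `φ : L → N`, so that
`φ ∘ π` is a free presentation of `N` with a kernel `T ⊇ R`, the natural map
`(R ∩ F') / (F ◇ R + R ◇ F) → (T ∩ F') / (F ◇ T + T ◇ F)` induced by the inclusion. -/
def presMap (φ : TriHom 𝕜 L N) (π : TriHom 𝕜 F L) :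
    PresMultiplier π →ₗ[𝕜] PresMultiplier (φ.comp π) :=
  Submodule.mapQ _ _ (Submodule.inclusion (presNumerator_mono φ π))
    (fun _ hx => presCommutator_mono φ π hx)

/-- The natural map `β : M(L) → M(L / Z)`, in terms of a free presentation `π : F → L`. -/
def triBeta (Z : TriIdeal 𝕜 L) (π : TriHom 𝕜 F L) :
    PresMultiplier π →ₗ[𝕜] PresMultiplier (Z.mkHom.comp π) :=
  presMap Z.mkHom π

end Presentation

/-! ### Homomorphisms, derived algebras and the commutator `F ◇ R + R ◇ F`. -/

section Homomorphisms

variable {𝕜 : Type*} {F E L : Type*} [Field 𝕜]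
  [AddCommGroup F] [Module 𝕜 F] [TriAlgebra 𝕜 F]
  [AddCommGroup E] [Module 𝕜 E] [TriAlgebra 𝕜 E]
  [AddCommGroup L] [Module 𝕜 L] [TriAlgebra 𝕜 L]

/-! Write `R = ker π`, `T = π⁻¹(Z)`, `C_R = F ◇ R + R ◇ F` and `C_T = F ◇ T + T ◇ F`. Conditions 1,
2 and 4 all amount to `C_T ≤ C_R`. Since `Z` is central, `C_T` lies in `R ∩ F'`, so `ker β = C_T /
C_R` (`triBeta_injective_iff`). A linear form on `F` killing `C_R` induces a cocycle on `L`; if `δ =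
0`, that cocycle vanishes against `Z`, so the form kills `C_T` too
(`presCommutator_le_of_triDelta_eq_zero`). If `C_T ≤ C_R`, lifting `π` to any central extension `E`
lifts `Z` into the center of `E` (`le_triZStar_of_presCommutator_le`). Finally, every scalar cocycle
defines a central extension, whose center detects whether the cocycle vanishes against `Z`
(`IsTriCocycle.apply_eq_zero_of_mem_triZStar`).

Condition 3 is a dimension count on the exact sequence `M(L) → M(L/Z) → L' ∩ Z → 0`. It uses that
the ideal of a maximal defining pair has the dimension of `(R ∩ F') / C_R`
(`IsMaximalDefiningPair.finrank_eq`). -/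

theorem TriHom.apply_op (φ : TriHom 𝕜 F L) (o : TriOp) (x y : F) :
    φ.toLinearMap (TriAlgebra.op (𝕜 := 𝕜) o x y) =
      TriAlgebra.op (𝕜 := 𝕜) o (φ.toLinearMap x) (φ.toLinearMap y) :=
  φ.map_op o x y

/-- The kernel of a homomorphism as an ideal. -/
def TriHom.kerIdeal (φ : TriHom 𝕜 F L) : TriIdeal 𝕜 F where
  toSubmodule := LinearMap.ker φ.toLinearMap
  op_left_mem := fun o x y hy => by
    have hy : φ.toLinearMap y = 0 := hy
    change φ.toLinearMap _ = 0
    rw [φ.apply_op, hy, map_zero]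
  op_right_mem := fun o x y hx => by
    have hx : φ.toLinearMap x = 0 := hx
    change φ.toLinearMap _ = 0
    rw [φ.apply_op, hx, map_zero, LinearMap.zero_apply]

/-- Free triassociative algebras are projective. -/
theorem FreeTri.exists_comp_eq {X : Type*} (π : TriHom 𝕜 (FreeTri 𝕜 X) L) (ω : TriHom 𝕜 E L)
    (hω : Function.Surjective ω.toLinearMap) :
    ∃ φ : TriHom 𝕜 (FreeTri 𝕜 X) E, ∀ y, ω.toLinearMap (φ.toLinearMap y) = π.toLinearMap y := by
  choose g hg using fun x : X => hω (π.toLinearMap (FreeTri.of 𝕜 x))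
  obtain ⟨φ, hφ, -⟩ := FreeTri.existsUnique_lift (𝕜 := 𝕜) g
  have h : ω.comp φ = π :=
    (FreeTri.existsUnique_lift (𝕜 := 𝕜) fun x => π.toLinearMap (FreeTri.of 𝕜 x)).unique
      (fun x => (congrArg ω.toLinearMap (hφ x)).trans (hg x)) fun _ => rfl
  exact ⟨φ, fun y => by rw [← h]; rfl⟩

theorem op_mem_triDerived (o : TriOp) (x y : L) :
    TriAlgebra.op (𝕜 := 𝕜) o x y ∈ triDerived 𝕜 L :=
  (le_iSup (fun o => Submodule.map₂ (TriAlgebra.op (𝕜 := 𝕜) (L := L) o) ⊤ ⊤) o)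
    (Submodule.apply_mem_map₂ _ trivial trivial)

theorem triDerived_le_iff {p : Submodule 𝕜 L} :
    triDerived 𝕜 L ≤ p ↔ ∀ (o : TriOp) (x y : L), TriAlgebra.op (𝕜 := 𝕜) o x y ∈ p :=
  ⟨fun h o x y => h (op_mem_triDerived o x y),
    fun h => iSup_le fun o => Submodule.map₂_le.2 fun x _ y _ => h o x y⟩

theorem map_triDerived_le (φ : TriHom 𝕜 F L) :
    (triDerived 𝕜 F).map φ.toLinearMap ≤ triDerived 𝕜 L := by
  rw [Submodule.map_le_iff_le_comap, triDerived_le_iff]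
  intro o x y
  rw [Submodule.mem_comap, φ.apply_op]
  exact op_mem_triDerived _ _ _

theorem presCommutator_le_iff (π : TriHom 𝕜 F L) {p : Submodule 𝕜 F} :
    presCommutator π ≤ p ↔ ∀ (o : TriOp) (x r : F), π.toLinearMap r = 0 →
      TriAlgebra.op (𝕜 := 𝕜) o x r ∈ p ∧ TriAlgebra.op (𝕜 := 𝕜) o r x ∈ p := by
  simp only [presCommutator, triDiamond, sup_le_iff, iSup_le_iff, Submodule.map₂_le,
    LinearMap.mem_ker, Submodule.mem_top, true_implies]
  exact ⟨fun h o x r hr => ⟨h.1 o x r hr, h.2 o r hr x⟩,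
    fun h => ⟨fun o x r hr => (h o x r hr).1, fun o r hr x => (h o x r hr).2⟩⟩

theorem op_mem_presCommutator (π : TriHom 𝕜 F L) (o : TriOp) (x : F) {r : F}
    (hr : π.toLinearMap r = 0) : TriAlgebra.op (𝕜 := 𝕜) o x r ∈ presCommutator π :=
  ((presCommutator_le_iff π).1 le_rfl o x r hr).1

theorem op_mem_presCommutator' (π : TriHom 𝕜 F L) (o : TriOp) (x : F) {r : F}
    (hr : π.toLinearMap r = 0) : TriAlgebra.op (𝕜 := 𝕜) o r x ∈ presCommutator π :=
  ((presCommutator_le_iff π).1 le_rfl o x r hr).2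

theorem presCommutator_le_presNumerator (π : TriHom 𝕜 F L) :
    presCommutator π ≤ presNumerator π := by
  rw [presCommutator_le_iff]
  intro o x r hr
  refine ⟨⟨?_, op_mem_triDerived _ _ _⟩, ⟨?_, op_mem_triDerived _ _ _⟩⟩ <;>
  · change π.toLinearMap _ = 0
    simp [π.apply_op, hr]

/-- A lift `φ` of `π` sends `R` into `ker ω`, which is central, so it kills every product with a
factor in `R`. -/
theorem presCommutator_le_ker (π : TriHom 𝕜 F L) (ω : TriHom 𝕜 E L) (φ : TriHom 𝕜 F E)
    (hω : LinearMap.ker ω.toLinearMap ≤ triCenter 𝕜 E)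
    (h : ∀ y, ω.toLinearMap (φ.toLinearMap y) = π.toLinearMap y) :
    presCommutator π ≤ LinearMap.ker φ.toLinearMap := by
  rw [presCommutator_le_iff]
  intro o x r hr
  have hc : φ.toLinearMap r ∈ triCenter 𝕜 E := hω (by rw [LinearMap.mem_ker, h, hr])
  simp only [LinearMap.mem_ker, φ.apply_op]
  exact ⟨(hc o _).2, (hc o _).1⟩

/-- Products only depend on the classes modulo the kernel, up to `F ◇ R + R ◇ F`. -/
theorem op_sub_op_mem_presCommutator (π : TriHom 𝕜 F L) (o : TriOp) {x x' y y' : F}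
    (hx : π.toLinearMap x = π.toLinearMap x') (hy : π.toLinearMap y = π.toLinearMap y') :
    TriAlgebra.op (𝕜 := 𝕜) o x y - TriAlgebra.op (𝕜 := 𝕜) o x' y' ∈ presCommutator π := by
  have h : TriAlgebra.op (𝕜 := 𝕜) o x y - TriAlgebra.op (𝕜 := 𝕜) o x' y' =
      TriAlgebra.op (𝕜 := 𝕜) o x (y - y') + TriAlgebra.op (𝕜 := 𝕜) o (x - x') y' := by
    simp
  rw [h]
  exact add_mem (op_mem_presCommutator π o x (by simp [hy]))
    (op_mem_presCommutator' π o y' (by simp [hx]))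

end Homomorphisms

/-! ### Cocycles, the central extensions they define, and `δ`. -/

section CocycleExtension

variable {𝕜 : Type u} {L : Type v} {V : Type w} [Field 𝕜] [AddCommGroup L] [Module 𝕜 L]
  [TriAlgebra 𝕜 L] [AddCommGroup V] [Module 𝕜 V]

/-- The 2-cocycle identities for a triple of bilinear maps with values in `V`. -/
def IsTriCocycle (f : TriOp → L →ₗ[𝕜] L →ₗ[𝕜] V) : Prop :=
  ∀ ⦃a b c d : TriOp⦄, TriRel a b c d → ∀ x y z : L,
    f b (TriAlgebra.op (𝕜 := 𝕜) a x y) z = f c x (TriAlgebra.op (𝕜 := 𝕜) d y z)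

/-- The products on `V × L` defined by a triple of bilinear maps `f`. -/
def extProduct (f : TriOp → L →ₗ[𝕜] L →ₗ[𝕜] V) (o : TriOp) :
    (V × L) →ₗ[𝕜] (V × L) →ₗ[𝕜] (V × L) :=
  LinearMap.mk₂ 𝕜 (fun p q => (f o p.2 q.2, TriAlgebra.op (𝕜 := 𝕜) o p.2 q.2))
    (fun p p' q => by simp) (fun c p q => by simp) (fun p q q' => by simp) (fun c p q => by simp)

/-- The central extension of `L` by `V` defined by a cocycle. -/
def TriExt {f : TriOp → L →ₗ[𝕜] L →ₗ[𝕜] V} (_ : IsTriCocycle f) : Type (max v w) := V × L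

namespace TriExt

variable {f : TriOp → L →ₗ[𝕜] L →ₗ[𝕜] V} (hf : IsTriCocycle f)

instance : AddCommGroup (TriExt hf) := inferInstanceAs (AddCommGroup (V × L))

instance : Module 𝕜 (TriExt hf) := inferInstanceAs (Module 𝕜 (V × L))

instance : TriAlgebra 𝕜 (TriExt hf) where
  op := extProduct f
  rel := fun h x y z => Prod.ext (hf h x.2 y.2 z.2) (TriAlgebra.rel h x.2 y.2 z.2)

/-- The projection of the extension onto `L`. -/
def proj : TriHom 𝕜 (TriExt hf) L where
  toLinearMap := LinearMap.snd 𝕜 V L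
  map_op := fun _ _ _ => rfl

theorem proj_surjective : Function.Surjective (proj hf).toLinearMap := fun x => ⟨(0, x), rfl⟩

theorem op_eq (o : TriOp) (p q : TriExt hf) :
    TriAlgebra.op (𝕜 := 𝕜) o p q =
      ((f o p.2 q.2, TriAlgebra.op (𝕜 := 𝕜) o p.2 q.2) : V × L) := rfl

theorem ker_proj_le_triCenter : LinearMap.ker (proj hf).toLinearMap ≤ triCenter 𝕜 (TriExt hf) := by
  intro p hp o q
  have hp : p.2 = 0 := hp
  rw [op_eq, op_eq, hp]
  constructor <;> refine Prod.ext ?_ ?_ <;> simp <;> rfl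

theorem apply_eq_zero_of_mem_triCenter {p : TriExt hf} (hp : p ∈ triCenter 𝕜 (TriExt hf))
    (o : TriOp) (x : L) : f o p.2 x = 0 ∧ f o x p.2 = 0 :=
  ⟨congrArg Prod.fst (hp o ((0, x) : V × L)).1, congrArg Prod.fst (hp o ((0, x) : V × L)).2⟩

end TriExt

/-- The extension built from `f` is one of those intersected in `triZStar`, so `z` lifts to a
central `p` there; the first coordinates of the products of `p` with `(0, x)` are the values of `f`.
-/
theorem IsTriCocycle.apply_eq_zero_of_mem_triZStar {f : TriOp → L →ₗ[𝕜] L →ₗ[𝕜] 𝕜}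
    (hf : IsTriCocycle f) {z : L} (hz : z ∈ triZStar 𝕜 L) (o : TriOp) (x : L) :
    f o z x = 0 ∧ f o x z = 0 := by
  obtain ⟨p, hp, rfl⟩ := Submodule.mem_sInf.1 hz _
    ⟨TriExt hf, inferInstance, inferInstance, inferInstance, TriExt.proj hf,
      TriExt.proj_surjective hf, TriExt.ker_proj_le_triCenter hf, rfl⟩
  exact TriExt.apply_eq_zero_of_mem_triCenter hf hp o x

variable {F : Type*} [AddCommGroup F] [Module 𝕜 F] [TriAlgebra 𝕜 F]

/-- A linear map on `F` that vanishes on `F ◇ R + R ◇ F` induces a cocycle on `L`. -/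
theorem exists_cocycle_of_presCommutator_le_ker (π : TriHom 𝕜 F L)
    (hπ : Function.Surjective π.toLinearMap) (l : F →ₗ[𝕜] V)
    (hl : presCommutator π ≤ LinearMap.ker l) :
    ∃ f : TriOp → L →ₗ[𝕜] L →ₗ[𝕜] V, IsTriCocycle f ∧
      ∀ o x y, f o (π.toLinearMap x) (π.toLinearMap y) = l (TriAlgebra.op (𝕜 := 𝕜) o x y) := by
  -- A merely linear section is enough: changing representatives alters a product by an element of
  -- `F ◇ R + R ◇ F`, which `l` kills.
  obtain ⟨s, hs⟩ := π.toLinearMap.exists_rightInverse_of_surjective (LinearMap.range_eq_top.2 hπ)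
  have hs' : ∀ x, π.toLinearMap (s x) = x := fun x => LinearMap.congr_fun hs x
  have key : ∀ o x y, ((TriAlgebra.op (𝕜 := 𝕜) o).compr₂ l).compl₁₂ s s (π.toLinearMap x)
      (π.toLinearMap y) = l (TriAlgebra.op (𝕜 := 𝕜) o x y) := by
    intro o x y
    have := hl (op_sub_op_mem_presCommutator π o (hs' (π.toLinearMap x)) (hs' (π.toLinearMap y)))
    rw [LinearMap.mem_ker, map_sub, sub_eq_zero] at this
    simpa using this
  refine ⟨fun o => ((TriAlgebra.op (𝕜 := 𝕜) o).compr₂ l).compl₁₂ s s, ?_, key⟩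
  intro a b c d h x y z
  obtain ⟨x, rfl⟩ := hπ x
  obtain ⟨y, rfl⟩ := hπ y
  obtain ⟨z, rfl⟩ := hπ z
  rw [← π.apply_op, ← π.apply_op, key, key, TriAlgebra.rel h]

theorem triDelta_eq_zero_iff (Z : TriIdeal 𝕜 L) (hZ : Z.toSubmodule ≤ triCenter 𝕜 L) :
    triDelta Z hZ = 0 ↔ ∀ f ∈ triZ2 𝕜 L, ∀ (o : TriOp) (x : L), ∀ z ∈ Z.toSubmodule,
      f o z x = 0 ∧ f o x z = 0 := by
  constructor
  · intro h f hf o x z hz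
    have h0 : triDeltaZ2 Z hZ ⟨f, hf⟩ = 0 :=
      LinearMap.congr_fun h (Submodule.Quotient.mk ⟨f, hf⟩)
    have h1 := congrFun h0 o
    exact ⟨(triDeltaZ2_snd_mk Z hZ ⟨f, hf⟩ o x ⟨z, hz⟩).symm.trans (by rw [h1]; rfl),
      (triDeltaZ2_fst_mk Z hZ ⟨f, hf⟩ o x ⟨z, hz⟩).symm.trans (by rw [h1]; rfl)⟩
  · intro h
    refine LinearMap.ext fun c => ?_
    induction c using Submodule.Quotient.induction_on with | H f =>
    change triDeltaZ2 Z hZ f = 0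
    funext o
    refine Prod.ext ?_ ?_
    · ext x z
      exact (h f.1 f.2 o x z z.2).2
    · refine LinearMap.ext fun z => ?_
      ext x
      exact (h f.1 f.2 o x z z.2).1

end CocycleExtension

/-! ### The kernel and cokernel of `β`, and the finiteness of the multiplier. -/

section NaturalMap

variable {𝕜 : Type u} {L : Type v} [Field 𝕜] [AddCommGroup L] [Module 𝕜 L] [TriAlgebra 𝕜 L]
  {F : Type*} [AddCommGroup F] [Module 𝕜 F] [TriAlgebra 𝕜 F]

theorem mkHom_comp_apply_eq_zero_iff (Z : TriIdeal 𝕜 L) (π : TriHom 𝕜 F L) (t : F) :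
    (Z.mkHom.comp π).toLinearMap t = 0 ↔ π.toLinearMap t ∈ Z.toSubmodule :=
  Submodule.Quotient.mk_eq_zero _

/-- This is where centrality of `Z` enters: a product of `F` with `T` maps to a product of `L` with
`Z`, which is zero. -/
theorem presCommutator_mkHom_comp_le_presNumerator (Z : TriIdeal 𝕜 L)
    (hZ : Z.toSubmodule ≤ triCenter 𝕜 L) (π : TriHom 𝕜 F L) :
    presCommutator (Z.mkHom.comp π) ≤ presNumerator π := by
  rw [presCommutator_le_iff]
  intro o x t ht
  have hc := hZ ((mkHom_comp_apply_eq_zero_iff Z π t).1 ht) o (π.toLinearMap x)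
  exact ⟨⟨(π.apply_op o x t).trans hc.2, op_mem_triDerived _ _ _⟩,
    ⟨(π.apply_op o t x).trans hc.1, op_mem_triDerived _ _ _⟩⟩

theorem presMultiplier_mk_eq_zero_iff (π : TriHom 𝕜 F L) (x : presNumerator π) :
    (Submodule.Quotient.mk x : PresMultiplier π) = 0 ↔ (x : F) ∈ presCommutator π :=
  Submodule.Quotient.mk_eq_zero _

/-- The kernel of `β` is `((R ∩ F') ∩ C_T) / C_R`, and `C_T` already lies in `R ∩ F'`. -/
theorem triBeta_injective_iff (Z : TriIdeal 𝕜 L) (hZ : Z.toSubmodule ≤ triCenter 𝕜 L)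
    (π : TriHom 𝕜 F L) :
    Function.Injective (triBeta Z π) ↔
      presCommutator (Z.mkHom.comp π) ≤ presCommutator π := by
  rw [injective_iff_map_eq_zero]
  constructor
  · intro h x hx
    let y : presNumerator π := ⟨x, presCommutator_mkHom_comp_le_presNumerator Z hZ π hx⟩
    exact (presMultiplier_mk_eq_zero_iff π y).1
      (h _ ((presMultiplier_mk_eq_zero_iff (Z.mkHom.comp π) ⟨x, _⟩).2 hx))
  · intro h c hc
    induction c using Submodule.Quotient.induction_on with | H x =>
    exact (presMultiplier_mk_eq_zero_iff π x).2
      (h ((presMultiplier_mk_eq_zero_iff (Z.mkHom.comp π) ⟨x, _⟩).1 hc))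

/-- Linear forms separate a point from a subspace: a form killing `C_R` but not some `x ∈ C_T` would
induce a cocycle that does not vanish against `Z`. -/
theorem presCommutator_le_of_triDelta_eq_zero (Z : TriIdeal 𝕜 L)
    (hZ : Z.toSubmodule ≤ triCenter 𝕜 L) (π : TriHom 𝕜 F L)
    (hπ : Function.Surjective π.toLinearMap) (h : triDelta Z hZ = 0) :
    presCommutator (Z.mkHom.comp π) ≤ presCommutator π := by
  intro x hx
  by_contra hxC
  obtain ⟨l, hlx, hl⟩ := Submodule.exists_le_ker_of_notMem hxC
  obtain ⟨f, hf, hfl⟩ := exists_cocycle_of_presCommutator_le_ker π hπ l hl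
  have h0 := (triDelta_eq_zero_iff Z hZ).1 h f fun {_ _ _ _} r => hf r
  refine hlx (LinearMap.mem_ker.1
    ((presCommutator_le_iff (Z.mkHom.comp π)).2 (fun o y t ht => ?_) hx))
  have := h0 o (π.toLinearMap y) _ ((mkHom_comp_apply_eq_zero_iff Z π t).1 ht)
  simp only [LinearMap.mem_ker, ← hfl]
  exact ⟨this.2, this.1⟩

/-- The lift `φ : F → E` kills `C_R`, hence `C_T`. So for `t` above `z ∈ Z`, `φ t` has zero products
with `φ(F)`; since `E = φ(F) + ker ω` and `ker ω` is central, `φ t` is central. -/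
theorem le_triZStar_of_presCommutator_le {X : Type*} (Z : TriIdeal 𝕜 L)
    (π : TriHom 𝕜 (FreeTri 𝕜 X) L)
    (hπ : Function.Surjective π.toLinearMap)
    (h : presCommutator (Z.mkHom.comp π) ≤ presCommutator π) :
    Z.toSubmodule ≤ triZStar 𝕜 L := by
  intro z hz
  refine Submodule.mem_sInf.2 ?_
  rintro _ ⟨E, _, _, _, ω, hω, hker, rfl⟩
  obtain ⟨φ, hφ⟩ := FreeTri.exists_comp_eq π ω hω
  have hC := h.trans (presCommutator_le_ker π ω φ hker hφ)
  obtain ⟨t, rfl⟩ := hπ z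
  have ht := (mkHom_comp_apply_eq_zero_iff Z π t).2 hz
  refine ⟨φ.toLinearMap t, fun o e => ?_, hφ t⟩
  obtain ⟨y, hy⟩ := hπ (ω.toLinearMap e)
  have hk : e - φ.toLinearMap y ∈ triCenter 𝕜 E := hker (by simp [hφ, hy])
  have he : e = φ.toLinearMap y + (e - φ.toLinearMap y) := by abel
  rw [he, map_add, map_add, LinearMap.add_apply, (hk o _).1, (hk o _).2, add_zero, add_zero,
    ← φ.apply_op, ← φ.apply_op]
  exact ⟨hC (op_mem_presCommutator' _ o y ht), hC (op_mem_presCommutator _ o y ht)⟩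

/-- The cokernel of `β` is `L' ∩ Z`. -/
theorem exists_surjective_ker_eq_range_triBeta (Z : TriIdeal 𝕜 L)
    (hZ : Z.toSubmodule ≤ triCenter 𝕜 L) (π : TriHom 𝕜 F L)
    (hπ : Function.Surjective π.toLinearMap) :
    ∃ g : PresMultiplier (Z.mkHom.comp π) →ₗ[𝕜] ↥(triDerived 𝕜 L ⊓ Z.toSubmodule),
      Function.Surjective g ∧ LinearMap.ker g = LinearMap.range (triBeta Z π) := by
  have hmem : ∀ t ∈ presNumerator (Z.mkHom.comp π),
      π.toLinearMap t ∈ triDerived 𝕜 L ⊓ Z.toSubmodule := fun t ht =>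
    ⟨map_triDerived_le π ⟨t, ht.2, rfl⟩, (mkHom_comp_apply_eq_zero_iff Z π t).1 ht.1⟩
  -- The map is induced by `π` itself. Surjectivity comes from `π(F') = L'`; a class is killed
  -- exactly when its representative lies in `R ∩ F'`.
  refine ⟨Submodule.liftQ _ (π.toLinearMap.restrict hmem) fun t ht => ?_, ?_, ?_⟩
  · exact Subtype.ext (presCommutator_mkHom_comp_le_presNumerator Z hZ π ht).1
  · rintro ⟨z, hz', hz⟩
    have hle : triDerived 𝕜 L ≤ (triDerived 𝕜 F).map π.toLinearMap := by
      rw [triDerived_le_iff]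
      intro o x y
      obtain ⟨x, rfl⟩ := hπ x
      obtain ⟨y, rfl⟩ := hπ y
      exact ⟨_, op_mem_triDerived o x y, π.apply_op o x y⟩
    obtain ⟨t, ht, rfl⟩ := hle hz'
    exact ⟨Submodule.Quotient.mk ⟨t, (mkHom_comp_apply_eq_zero_iff Z π t).2 hz, ht⟩, rfl⟩
  · refine le_antisymm ?_ ?_
    · intro c hc
      induction c using Submodule.Quotient.induction_on with | H t =>
      exact ⟨Submodule.Quotient.mk ⟨t, congrArg Subtype.val hc, t.2.2⟩, rfl⟩
    · rintro _ ⟨c, rfl⟩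
      induction c using Submodule.Quotient.induction_on with | H t =>
      exact Subtype.ext t.2.1

/-- Modulo `F ◇ R + R ◇ F`, products in `F` depend only on the images of the factors in `L`. Hence
the three products on a finite-dimensional linear copy of `L` span `F'` modulo this subspace. -/
theorem finiteDimensional_presMultiplier [FiniteDimensional 𝕜 L] (π : TriHom 𝕜 F L)
    (hπ : Function.Surjective π.toLinearMap) : FiniteDimensional 𝕜 (PresMultiplier π) := by
  obtain ⟨s, hs⟩ := π.toLinearMap.exists_rightInverse_of_surjective (LinearMap.range_eq_top.2 hπ)
  have hs' : ∀ x, π.toLinearMap (s x) = x := fun x => LinearMap.congr_fun hs x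
  have : Finite TriOp := Finite.of_surjective
    (fun i : Fin 3 => match i with | 0 => TriOp.vdash | 1 => TriOp.dashv | 2 => TriOp.perp)
    (by rintro (_ | _ | _); exacts [⟨0, rfl⟩, ⟨1, rfl⟩, ⟨2, rfl⟩])
  have hsfg : (LinearMap.range s).FG := by
    rw [LinearMap.range_eq_map]
    exact Module.Finite.fg_top.map s
  let D : Submodule 𝕜 F := ⨆ o : TriOp,
    Submodule.map₂ (TriAlgebra.op (𝕜 := 𝕜) o) (LinearMap.range s) (LinearMap.range s)
  have hfg : D.FG := Submodule.fg_iSup _ fun o =>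
    Submodule.FG.map₂ _ hsfg hsfg
  have hle : triDerived 𝕜 F ≤ D ⊔ presCommutator π := by
    rw [triDerived_le_iff]
    intro o x y
    rw [← add_sub_cancel (TriAlgebra.op (𝕜 := 𝕜) o (s (π.toLinearMap x)) (s (π.toLinearMap y)))
      (TriAlgebra.op (𝕜 := 𝕜) o x y)]
    refine Submodule.add_mem_sup ?_
      (op_sub_op_mem_presCommutator π o (hs' _).symm (hs' _).symm)
    exact (le_iSup (fun o => Submodule.map₂ (TriAlgebra.op (𝕜 := 𝕜) o) (LinearMap.range s)
      (LinearMap.range s)) o) (Submodule.apply_mem_map₂ _ ⟨_, rfl⟩ ⟨_, rfl⟩)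
  have hfin : FiniteDimensional 𝕜 (D.map (presCommutator π).mkQ) :=
    Module.Finite.of_fg (hfg.map _)
  let j : PresMultiplier π →ₗ[𝕜] F ⧸ presCommutator π :=
    Submodule.mapQ _ _ (presNumerator π).subtype fun _ hx => hx
  have hj : Function.Injective j := by
    rw [injective_iff_map_eq_zero]
    intro c hc
    induction c using Submodule.Quotient.induction_on with | H x =>
    exact (presMultiplier_mk_eq_zero_iff π x).2
      ((Submodule.Quotient.mk_eq_zero (presCommutator π) (x := (x : F))).1 hc)
  have hr : ∀ c, j c ∈ D.map (presCommutator π).mkQ := by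
    intro c
    induction c using Submodule.Quotient.induction_on with | H x =>
    obtain ⟨d, hd, e, he, hde⟩ := Submodule.mem_sup.1 (hle x.2.2)
    refine ⟨d, hd, (Submodule.Quotient.eq _).2 ?_⟩
    change d - (x : F) ∈ _
    rw [← hde, sub_add_cancel_left]
    exact neg_mem he
  exact FiniteDimensional.of_injective (j.codRestrict _ hr) fun a b hab =>
    hj (congrArg Subtype.val hab)

end NaturalMap

/-! ### Maximal defining pairs and the Hopf formula. -/

section Multiplier

variable {𝕜 : Type u} {L : Type v} [Field 𝕜] [AddCommGroup L] [Module 𝕜 L] [TriAlgebra 𝕜 L]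

theorem IsDefiningPair.exists_hom {K : Type*} [AddCommGroup K] [Module 𝕜 K] [TriAlgebra 𝕜 K]
    {M : TriIdeal 𝕜 K} (h : IsDefiningPair 𝕜 L K M) :
    ∃ ω : TriHom 𝕜 K L, Function.Surjective ω.toLinearMap ∧
      LinearMap.ker ω.toLinearMap = M.toSubmodule := by
  obtain ⟨⟨φ, hφ⟩, -⟩ := h
  refine ⟨φ.comp M.mkHom, hφ.2.comp (Submodule.mkQ_surjective _), ?_⟩
  change LinearMap.ker (φ.toLinearMap ∘ₗ M.toSubmodule.mkQ) = _
  rw [LinearMap.ker_comp_of_ker_eq_bot _ (LinearMap.ker_eq_bot.2 hφ.1), Submodule.ker_mkQ]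

theorem isDefiningPair_kerIdeal {K : Type*} [AddCommGroup K] [Module 𝕜 K] [TriAlgebra 𝕜 K]
    (ω : TriHom 𝕜 K L) (hω : Function.Surjective ω.toLinearMap)
    (hker : LinearMap.ker ω.toLinearMap ≤ triCenter 𝕜 K ⊓ triDerived 𝕜 K) :
    IsDefiningPair 𝕜 L K ω.kerIdeal := by
  refine ⟨⟨⟨(LinearMap.ker ω.toLinearMap).liftQ ω.toLinearMap le_rfl, fun o x y => ?_⟩, ?_, ?_⟩,
    hker⟩
  · induction x using Submodule.Quotient.induction_on with | H x =>
    induction y using Submodule.Quotient.induction_on with | H y =>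
    exact ω.apply_op o x y
  · exact LinearMap.ker_eq_bot.1 (Submodule.ker_liftQ_eq_bot' _ _ rfl)
  · intro x
    obtain ⟨y, rfl⟩ := hω x
    exact ⟨Submodule.Quotient.mk y, rfl⟩

/-- In a defining pair `(K, M)`, the ideal `M` is a quotient of `(R ∩ F') / (F ◇ R + R ◇ F)`. -/
theorem IsDefiningPair.exists_surjective {X : Type*} (π : TriHom 𝕜 (FreeTri 𝕜 X) L)
    (hπ : Function.Surjective π.toLinearMap)
    {K : Type*} [AddCommGroup K] [Module 𝕜 K] [TriAlgebra 𝕜 K]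
    {M : TriIdeal 𝕜 K} (h : IsDefiningPair 𝕜 L K M) :
    ∃ g : PresMultiplier π →ₗ[𝕜] M.toSubmodule, Function.Surjective g := by
  obtain ⟨ω, hω, hker⟩ := h.exists_hom
  have hcen : LinearMap.ker ω.toLinearMap ≤ triCenter 𝕜 K := hker ▸ h.2.trans inf_le_left
  obtain ⟨φ, hφ⟩ := FreeTri.exists_comp_eq π ω hω
  have hmem : ∀ r ∈ presNumerator π, φ.toLinearMap r ∈ M.toSubmodule := by
    intro r hr
    rw [← hker, LinearMap.mem_ker, hφ]
    exact hr.1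
  refine ⟨Submodule.liftQ _ (φ.toLinearMap.restrict hmem) fun r hr => ?_, ?_⟩
  · exact Subtype.ext (presCommutator_le_ker π ω φ hcen hφ hr)
  -- `K = φ(F) + Z(K)`, and central summands do not affect products, so `K'` is contained in
  -- `φ(F')`. As `M ≤ K'`, this gives surjectivity.
  · have hdec : ∀ x : K, ∃ y, x - φ.toLinearMap y ∈ triCenter 𝕜 K := by
      intro x
      obtain ⟨y, hy⟩ := hπ (ω.toLinearMap x)
      exact ⟨y, hcen (by simp [hφ, hy])⟩
    have hle : triDerived 𝕜 K ≤ (triDerived 𝕜 (FreeTri 𝕜 X)).map φ.toLinearMap := by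
      rw [triDerived_le_iff]
      intro o x₁ x₂
      obtain ⟨y₁, h₁⟩ := hdec x₁
      obtain ⟨y₂, h₂⟩ := hdec x₂
      refine ⟨_, op_mem_triDerived o y₁ y₂, ?_⟩
      have e₁ : TriAlgebra.op (𝕜 := 𝕜) o x₁ x₂ =
          TriAlgebra.op (𝕜 := 𝕜) o (φ.toLinearMap y₁) x₂ := by
        rw [← sub_eq_zero, ← LinearMap.sub_apply, ← map_sub]
        exact (h₁ o x₂).1
      rw [φ.apply_op, e₁, eq_comm, ← sub_eq_zero, ← map_sub]
      exact (h₂ o _).2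
    rintro ⟨m, hm⟩
    obtain ⟨r, hr, rfl⟩ := hle (h.2 hm).2
    have hr0 : π.toLinearMap r = 0 := by
      rw [← hφ]
      exact (hker ▸ hm : φ.toLinearMap r ∈ LinearMap.ker ω.toLinearMap)
    exact ⟨Submodule.Quotient.mk ⟨r, hr0, hr⟩, rfl⟩

/-- Maximality is tested against a central extension of `L` by a copy `V` of `(R ∩ F') / (F ◇ R + R
◇ F)`, giving `dim V + dim L ≤ dim M + dim L`. -/
theorem finrank_le_of_isMaximalDefiningPair [FiniteDimensional 𝕜 L] {F : Type*} [AddCommGroup F]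
    [Module 𝕜 F] [TriAlgebra 𝕜 F] (π : TriHom 𝕜 F L)
    (hπ : Function.Surjective π.toLinearMap)
    {K : Type (max u v)} [AddCommGroup K] [Module 𝕜 K] [TriAlgebra 𝕜 K]
    {M : TriIdeal 𝕜 K} (h : IsMaximalDefiningPair 𝕜 L K M) [FiniteDimensional 𝕜 M.toSubmodule] :
    Module.finrank 𝕜 (PresMultiplier π) ≤ Module.finrank 𝕜 M.toSubmodule := by
  have := finiteDimensional_presMultiplier π hπ
  -- A coordinate space keeps the extension in `Type (max u v)`, the universe over which maximality
  -- quantifies.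
  let V : Type u := Fin (Module.finrank 𝕜 (PresMultiplier π)) → 𝕜
  let e : PresMultiplier π ≃ₗ[𝕜] V := LinearEquiv.ofFinrankEq _ _ (by simp [V])
  -- The quotient map on `R ∩ F'` is extended to all of `F`, since the cocycle needs its values on
  -- every product.
  obtain ⟨l, hl⟩ := LinearMap.exists_extend
    (e.toLinearMap ∘ₗ ((presCommutator π).submoduleOf (presNumerator π)).mkQ)
  have hl' : ∀ r : presNumerator π, l r = e (Submodule.Quotient.mk r) :=
    fun r => LinearMap.congr_fun hl r
  have hlC : presCommutator π ≤ LinearMap.ker l := by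
    intro c hc
    have := hl' ⟨c, presCommutator_le_presNumerator π hc⟩
    rw [LinearMap.mem_ker]
    refine this.trans ?_
    rw [(presMultiplier_mk_eq_zero_iff π ⟨c, _⟩).2 hc, map_zero]
  obtain ⟨f, hf, hfl⟩ := exists_cocycle_of_presCommutator_le_ker π hπ l hlC
  let ψ : TriHom 𝕜 F (TriExt hf) :=
    { toLinearMap := LinearMap.prod l π.toLinearMap
      map_op := fun o x y => Prod.ext (hfl o x y).symm (π.apply_op o x y) }
  -- `ψ = (l, π)` maps `R ∩ F'` onto `V × 0`, and it maps `F'` into the derived algebra.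
  have hder : LinearMap.ker (TriExt.proj hf).toLinearMap ≤ triDerived 𝕜 (TriExt hf) := by
    rintro ⟨a, b⟩ hb
    have hb : b = 0 := hb
    obtain ⟨c, rfl⟩ := e.surjective a
    induction c using Submodule.Quotient.induction_on with | H r =>
    refine map_triDerived_le ψ ⟨r, r.2.2, ?_⟩
    exact Prod.ext (hl' r) (r.2.1.trans hb.symm)
  have hpair := isDefiningPair_kerIdeal (TriExt.proj hf) (TriExt.proj_surjective hf)
    (le_inf (TriExt.ker_proj_le_triCenter hf) hder)
  have hrank := h.2 (TriExt hf) _ hpair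
  obtain ⟨ω, hω, hker⟩ := h.1.exists_hom
  have eK : (K ⧸ M.toSubmodule) ≃ₗ[𝕜] L :=
    (Submodule.quotEquivOfEq _ _ hker.symm).trans
      (LinearMap.quotKerEquivOfSurjective ω.toLinearMap hω)
  have : FiniteDimensional 𝕜 (K ⧸ M.toSubmodule) := Module.Finite.equiv eK.symm
  have hKfin : FiniteDimensional 𝕜 K := Module.Finite.of_submodule_quotient M.toSubmodule
  have hEfin : FiniteDimensional 𝕜 (TriExt hf) := inferInstanceAs (FiniteDimensional 𝕜 (V × L))
  have hrank' : Module.finrank 𝕜 (V × L) ≤ Module.finrank 𝕜 K := by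
    rw [← Module.finrank_eq_rank, ← Module.finrank_eq_rank] at hrank
    exact_mod_cast hrank
  rw [Module.finrank_prod, ← Submodule.finrank_quotient_add_finrank M.toSubmodule,
    eK.finrank_eq] at hrank'
  have hV : Module.finrank 𝕜 V = Module.finrank 𝕜 (PresMultiplier π) := by simp [V]
  omega

/-- Freeness of the presentation bounds `dim M` above; maximality bounds it below. -/
theorem IsMaximalDefiningPair.finrank_eq [FiniteDimensional 𝕜 L] {X : Type*}
    (π : TriHom 𝕜 (FreeTri 𝕜 X) L) (hπ : Function.Surjective π.toLinearMap)
    {K : Type (max u v)} [AddCommGroup K] [Module 𝕜 K] [TriAlgebra 𝕜 K]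
    {M : TriIdeal 𝕜 K} (h : IsMaximalDefiningPair 𝕜 L K M) :
    FiniteDimensional 𝕜 M.toSubmodule ∧
      Module.finrank 𝕜 M.toSubmodule = Module.finrank 𝕜 (PresMultiplier π) := by
  have := finiteDimensional_presMultiplier π hπ
  obtain ⟨g, hg⟩ := h.1.exists_surjective π hπ
  have hfin : FiniteDimensional 𝕜 M.toSubmodule := Module.Finite.of_surjective g hg
  exact ⟨hfin, le_antisymm (LinearMap.finrank_le_finrank_of_surjective hg)
    (finrank_le_of_isMaximalDefiningPair π hπ h)⟩

end Multiplier

/-! ### Condition 3 as an identity of dimensions, and the equivalences. -/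

theorem exists_injective_quotient_equiv_iff {𝕜 A B C : Type*} [Field 𝕜]
    [AddCommGroup A] [Module 𝕜 A] [FiniteDimensional 𝕜 A]
    [AddCommGroup B] [Module 𝕜 B] [FiniteDimensional 𝕜 B]
    [AddCommGroup C] [Module 𝕜 C] [FiniteDimensional 𝕜 C] :
    (∃ i : C →ₗ[𝕜] B, Function.Injective i ∧ Nonempty (A ≃ₗ[𝕜] (B ⧸ LinearMap.range i))) ↔
      Module.finrank 𝕜 A + Module.finrank 𝕜 C = Module.finrank 𝕜 B := by
  constructor
  · rintro ⟨i, hi, ⟨e⟩⟩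
    rw [e.finrank_eq, ← LinearMap.finrank_range_of_inj hi, Submodule.finrank_quotient_add_finrank]
  · intro h
    obtain ⟨i, hi⟩ := finrank_le_iff_exists_linearMap.1
      (show Module.finrank 𝕜 C ≤ Module.finrank 𝕜 B by omega)
    refine ⟨i, hi, ⟨LinearEquiv.ofFinrankEq _ _ ?_⟩⟩
    have h₁ := Submodule.finrank_quotient_add_finrank (LinearMap.range i)
    rw [LinearMap.finrank_range_of_inj hi] at h₁
    omega

/-- Rank–nullity for `β` and for its cokernel map onto `L' ∩ Z` shows that the two sides of the
identity differ by `dim ker β`. -/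
theorem triBeta_injective_iff_finrank {𝕜 L F : Type*} [Field 𝕜] [AddCommGroup L] [Module 𝕜 L]
    [TriAlgebra 𝕜 L] [FiniteDimensional 𝕜 L] [AddCommGroup F] [Module 𝕜 F] [TriAlgebra 𝕜 F]
    (Z : TriIdeal 𝕜 L) (hZ : Z.toSubmodule ≤ triCenter 𝕜 L) (π : TriHom 𝕜 F L)
    (hπ : Function.Surjective π.toLinearMap) :
    Function.Injective (triBeta Z π) ↔
      Module.finrank 𝕜 (PresMultiplier π) +
          Module.finrank 𝕜 ↥(triDerived 𝕜 L ⊓ Z.toSubmodule) =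
        Module.finrank 𝕜 (PresMultiplier (Z.mkHom.comp π)) := by
  have := finiteDimensional_presMultiplier π hπ
  have := finiteDimensional_presMultiplier (Z.mkHom.comp π)
    ((Submodule.mkQ_surjective _).comp hπ)
  obtain ⟨g, hg, hgker⟩ := exists_surjective_ker_eq_range_triBeta Z hZ π hπ
  have h₁ := LinearMap.finrank_range_add_finrank_ker g
  have h₂ := LinearMap.finrank_range_add_finrank_ker (triBeta Z π)
  rw [hgker, LinearMap.range_eq_top.2 hg, finrank_top] at h₁
  rw [← LinearMap.ker_eq_bot, ← Submodule.finrank_eq_zero]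
  omega

theorem mainTheorem1 {𝕜 : Type u} {L : Type v} [Field 𝕜] [AddCommGroup L] [Module 𝕜 L]
    [TriAlgebra 𝕜 L] [FiniteDimensional 𝕜 L]
    (Z : TriIdeal 𝕜 L) (hZ : Z.toSubmodule ≤ triCenter 𝕜 L)
    -- a free presentation of `L`, by which the natural map `β` is expressed
    {X : Type w} (π : TriHom 𝕜 (FreeTri 𝕜 X) L) (hπ : Function.Surjective π.toLinearMap)
    -- `M = M(L)`
    {K : Type (max u v)} [AddCommGroup K] [Module 𝕜 K] [TriAlgebra 𝕜 K] (M : TriIdeal 𝕜 K)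
    (hM : IsMaximalDefiningPair 𝕜 L K M)
    -- `MZ = M(L / Z)`
    {KZ : Type (max u v)} [AddCommGroup KZ] [Module 𝕜 KZ] [TriAlgebra 𝕜 KZ] (MZ : TriIdeal 𝕜 KZ)
    (hMZ : IsMaximalDefiningPair 𝕜 (L ⧸ Z.toSubmodule) KZ MZ) :
    List.TFAE
      [triDelta Z hZ = 0,
       Function.Injective (triBeta Z π),
       ∃ i : ↥(triDerived 𝕜 L ⊓ Z.toSubmodule) →ₗ[𝕜] MZ.toSubmodule, Function.Injective i ∧
         Nonempty (M.toSubmodule ≃ₗ[𝕜] (MZ.toSubmodule ⧸ LinearMap.range i)),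
       Z.toSubmodule ≤ triZStar 𝕜 L] := by
  have hπZ : Function.Surjective (Z.mkHom.comp π).toLinearMap :=
    (Submodule.mkQ_surjective _).comp hπ
  obtain ⟨hMfin, hMdim⟩ := hM.finrank_eq π hπ
  obtain ⟨hMZfin, hMZdim⟩ := hMZ.finrank_eq (Z.mkHom.comp π) hπZ
  tfae_have 1 → 2 := fun h => (triBeta_injective_iff Z hZ π).2
    (presCommutator_le_of_triDelta_eq_zero Z hZ π hπ h)
  tfae_have 2 → 4 := fun h => le_triZStar_of_presCommutator_le Z π hπ
    ((triBeta_injective_iff Z hZ π).1 h)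
  tfae_have 4 → 1 := fun h => (triDelta_eq_zero_iff Z hZ).2 fun f hf o x z hz =>
    IsTriCocycle.apply_eq_zero_of_mem_triZStar (f := f) (fun _ _ _ _ r => hf r) (h hz) o x
  -- The isomorphism in condition 3 need not come from `β`: for finite-dimensional spaces its
  -- existence only says that the dimensions add up.
  tfae_have 2 ↔ 3 := by
    rw [triBeta_injective_iff_finrank Z hZ π hπ, exists_injective_quotient_equiv_iff, hMdim, hMZdim]
  tfae_finish
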